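/- **Theorem (MLP universal approximation of choice probabilities).** Let $f:\mathbb R^K\to[0,\infty)$ be a probability density with respect to Lebesgue measure which is exchangeable, i.e. $f(P_\pi e)=f(e)$ for every $e\in\mathbb R^K$ and every permutation matrix $P_\pi$. For $v\in\mathbb R^K$ and a symmetric positive semidefinite matrix $\Sigma\in\mathbb R^{K\times K}$ with positive semidefinite square root $\Sigma^{1/2}$, put $$P_j(v,\Sigma)=\int_{\mathcal R_j(v,\Sigma)}f(e)\,de,\qquad \mathcal R_j(v,\Sigma)=\{e\in\mathbb R^K: v_j+(\Sigma^{1/2}e)_j\ge v_k+(\Sigma^{1/2}e)_k\ \text{for all }k\ne j\}.$$ Let $\mathcal X_K$ be the set of pairs $(v,Y)$ with $v\in\mathbb R^K$, $Y\in\mathbb R^{K\times K}$ symmetric, $\sum_i v_i=0$, $Y\mathbf 1=0$ and $\operatorname{tr}Y=K$. Fix $j\in\{1,\dots,K\}$. Let $\mathcal B_j\subset\mathcal X_K$ be the set of $(v,Y)\in\mathcal X_K$ for which at least one of the following fails: (a) the triples $(v_k,Y_{kk},Y_{jk})$, $k\neq j$, are pairwise distinct, and the entries $Y_{kl}$ with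 $k<l$, $k\ne j$, $l\neq j$ are pairwise distinct; (b) for each $k\ne j$ there is exactly one set $S$ of $K-2$ positions $(m,l)$ with $m<l$, $m\neq j$, $l\ne j$ such that $\sum_{(m,l)\in S}Y_{ml}=-Y_{kk}-Y_{jk}$. Let $G_j(v,Y)\in\mathbb R^{3(K-1)+(K-1)(K-2)/2}$ be the vector of sorted components of $g_j(v,Y)$: the triples $(v_k,Y_{kk},Y_{jk})$, $k\ne j$, listed in lexicographic order, followed by the entries $Y_{kl}$ ($k<l$; $k,l\ne j$) listed in increasing order. Let $\sigma:\mathbb R\to\mathbb R$ be a continuous activation function that is not a polynomial. Let $C\subset\mathcal X_K\setminus\mathcal B_j$ be a compact set such that for every $(v,Y)\in C$ the matrix $Y$ is positive semidefinite and there is no $k\neq j$ with both $v_k=v_j$ and $Y_{jj}+Y_{kk}-2Y_{jk}=0$ (that is, no other alternative has the same random utility as $j$). Then for every $\varepsilon>0$ there is a multi-layer perceptron $N$ with activation $\sigma$, at least one hidden layer and an affine output layer such that $$\sup_{(v,Y)\in C}\bigl|N(G_j(v,Y))-P_j(v,Y)\bigr|\le\varepsilon.$$ -/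

import Mathlib

open MeasureTheory

namespace DiscreteChoice

noncomputable section

/-- Assumption on the base error vector: `f` is a probability density with respect to Lebesgue
measure on `ℝ^K`, invariant under every permutation of the coordinates. -/
structure IsExchangeableDensity {K : ℕ} (f : (Fin K → ℝ) → ℝ) : Prop where
  measurable : Measurable f
  nonneg : ∀ e, 0 ≤ f e
  lintegral_eq_one : ∫⁻ e, ENNReal.ofReal (f e) = 1
  exchangeable : ∀ (π : Equiv.Perm (Fin K)) (e : Fin K → ℝ), f (e ∘ π) = f e

/-- The (symmetric, positive semidefinite) square root `Σ^{1/2}` of a positive semidefinite real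
matrix. -/
def sqrtMatrix {K : ℕ} (S : Matrix (Fin K) (Fin K) ℝ) : Matrix (Fin K) (Fin K) ℝ :=
  open scoped MatrixOrder in CFC.sqrt S

/-- The utility `U_k = v_k + [Σ^{1/2} ε]_k` of alternative `k` for the base error `e`. -/
def utility {K : ℕ} (v : Fin K → ℝ) (S : Matrix (Fin K) (Fin K) ℝ) (e : Fin K → ℝ) (k : Fin K) :
    ℝ :=
  v k + (sqrtMatrix S).mulVec e k

/-- The region of the error space in which alternative `j` is chosen. -/
def choiceRegion {K : ℕ} (j : Fin K) (v : Fin K → ℝ) (S : Matrix (Fin K) (Fin K) ℝ) :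
    Set (Fin K → ℝ) :=
  {e | ∀ k, k ≠ j → utility v S e k ≤ utility v S e j}

/-- The choice probability `P_j(v, Σ)`. -/
def choiceProb {K : ℕ} (f : (Fin K → ℝ) → ℝ) (j : Fin K) (v : Fin K → ℝ)
    (S : Matrix (Fin K) (Fin K) ℝ) : ℝ :=
  ∫ e in choiceRegion j v S, f e

/-- The centered, trace-normalized utility-covariance space `𝒳_K`. -/
def centeredSpace (K : ℕ) : Set ((Fin K → ℝ) × Matrix (Fin K) (Fin K) ℝ) :=
  {x | x.2.IsSymm ∧ ∑ i, x.1 i = 0 ∧ x.2.mulVec (fun _ => 1) = 0 ∧ x.2.trace = K}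

/-- The alternatives other than `j`. -/
def others {K : ℕ} (j : Fin K) : Finset (Fin K) :=
  Finset.univ.filter fun k => k ≠ j

/-- The off-diagonal positions `(k, l)`, `k < l`, of the submatrix with row and column `j`
removed. -/
def offPositions {K : ℕ} (j : Fin K) : Finset (Fin K × Fin K) :=
  Finset.univ.filter fun p => p.1 < p.2 ∧ p.1 ≠ j ∧ p.2 ≠ j

/-- The triple `(v_k, Y_kk, Y_jk)`, with the lexicographic order on triples. -/
def triple {K : ℕ} (j : Fin K) (x : (Fin K → ℝ) × Matrix (Fin K) (Fin K) ℝ) (k : Fin K) :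
    ℝ ×ₗ ℝ ×ₗ ℝ :=
  toLex (x.1 k, toLex (x.2 k k, x.2 j k))

/-- The multiset `𝒯_j` of triples. -/
def tripleMultiset {K : ℕ} (j : Fin K) (x : (Fin K → ℝ) × Matrix (Fin K) (Fin K) ℝ) :
    Multiset (ℝ ×ₗ ℝ ×ₗ ℝ) :=
  (others j).val.map (triple j x)

/-- The multiset `𝒪_j` of off-diagonal entries away from `j`. -/
def offMultiset {K : ℕ} (j : Fin K) (x : (Fin K → ℝ) × Matrix (Fin K) (Fin K) ℝ) :
    Multiset ℝ :=
  (offPositions j).val.map fun p => x.2 p.1 p.2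

/-- The exceptional set `ℬ_j`: the points of `𝒳_K` at which one of the genericity conditions
fails. -/
def exceptionalSet {K : ℕ} (j : Fin K) : Set ((Fin K → ℝ) × Matrix (Fin K) (Fin K) ℝ) :=
  {x | x ∈ centeredSpace K ∧
    ¬ ((Set.InjOn (triple j x) (others j) ∧
        Set.InjOn (fun p : Fin K × Fin K => x.2 p.1 p.2) (offPositions j)) ∧
      ∀ k, k ≠ j → ∃! T : Finset (Fin K × Fin K),
        T ⊆ offPositions j ∧ T.card = K - 2 ∧ ∑ p ∈ T, x.2 p.1 p.2 = -x.2 k k - x.2 j k)}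

/-- The points at which `P_j` is a choice probability without structural ties: the scale matrix
has a square root, and no other alternative `k` has `v_k = v_j` together with
`Σ_jj + Σ_kk - 2 Σ_jk = 0` (which would make `U_k` and `U_j` identical). -/
def choiceDomain {K : ℕ} (j : Fin K) : Set ((Fin K → ℝ) × Matrix (Fin K) (Fin K) ℝ) :=
  {x | x.2.PosSemidef ∧
    ∀ k, k ≠ j → ¬ (x.1 k = x.1 j ∧ x.2 j j + x.2 k k - 2 * x.2 j k = 0)}

/-- Labels of the real components of `g_j`: three for each of the `K - 1` triples, and one for each
of the `(K - 1)(K - 2) / 2` off-diagonal entries. -/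
abbrev FeatureIndex {K : ℕ} (j : Fin K) : Type :=
  (Fin (others j).card × Fin 3) ⊕ Fin (offPositions j).card

/-- The `i`-th triple of `𝒯_j` in lexicographic order. -/
def sortedTriple {K : ℕ} (j : Fin K) (x : (Fin K → ℝ) × Matrix (Fin K) (Fin K) ℝ)
    (i : Fin (others j).card) : ℝ ×ₗ ℝ ×ₗ ℝ :=
  ((tripleMultiset j x).sort (· ≤ ·))[i.1]'(by simp [tripleMultiset])

/-- The `i`-th entry of `𝒪_j` in increasing order. -/
def sortedOff {K : ℕ} (j : Fin K) (x : (Fin K → ℝ) × Matrix (Fin K) (Fin K) ℝ)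
    (i : Fin (offPositions j).card) : ℝ :=
  ((offMultiset j x).sort (· ≤ ·))[i.1]'(by simp [offMultiset])

/-- The sorted components of `g_j`, as a real vector. -/
def features {K : ℕ} (j : Fin K) (x : (Fin K → ℝ) × Matrix (Fin K) (Fin K) ℝ) :
    FeatureIndex j → ℝ
  | Sum.inl (i, c) =>
      ![(ofLex (sortedTriple j x i)).1, (ofLex (ofLex (sortedTriple j x i)).2).1,
        (ofLex (ofLex (sortedTriple j x i)).2).2] c
  | Sum.inr i => sortedOff j x i

/-- Multi-layer perceptrons (weights and biases) with inputs indexed by `ι`, one real output, and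
at least one hidden layer. -/
inductive MLP : Type → Type 1
  | shallow {ι : Type} {h : ℕ} (W : Matrix (Fin h) ι ℝ) (b : Fin h → ℝ) (a : Fin h → ℝ) (c : ℝ) :
      MLP ι
  | deep {ι : Type} {h : ℕ} (W : Matrix (Fin h) ι ℝ) (b : Fin h → ℝ) (N : MLP (Fin h)) : MLP ι

/-- The function computed by a perceptron with activation `σ`: each hidden layer is
`z ↦ σ(W z + b)`, with `σ` applied coordinatewise, and the output layer is affine. -/
def MLP.eval (σ : ℝ → ℝ) : {ι : Type} → [Fintype ι] → MLP ι → (ι → ℝ) → ℝ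
  | _, _, .shallow W b a c, z => ∑ i, a i * σ (W.mulVec z i + b i) + c
  | _, _, .deep W b N, z => N.eval σ fun i => σ (W.mulVec z i + b i)

end

end DiscreteChoice

/-
Listing the triples in lexicographic order is not continuous, so `C` is not mapped continuously to
the inputs of the network. Listing the components along any fixed enumeration is continuous, and the
images of `C` under the finitely many enumerations form a compact set `D` that contains every sorted
list. On `D` the value `P_j` is well defined. By (b), a coincidence of two lists matches the
off-diagonal entries row by row, and since two rows meet in a single position, the two points of `C`
differ by a permutation of the alternatives other than `j`; exchangeability makes `P_j` invariant
under it. Since no alternative ties with `j` almost surely, `P_j` is continuous on `C`, hence it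
induces a continuous function on `D`.

The approximation on `D` is the theorem of Leshno, Lin, Pinkus and Schocken. If a continuous linear
functional kills all functions `σ (t * u + b)`, then so it does for every mollification of `σ`.
Some mollification has a nonvanishing `n`-th derivative at some point, and differentiating `n` times
in `t` at `0` shows that the functional kills `u ^ n`. Hence it kills `exp u`, and it is `0` by the
Stone-Weierstrass theorem.
-/

namespace DiscreteChoice

open Filter Polynomial
open scoped Convolution Matrix Topology

section Polynomials

theorem exists_mem_degreeLT_derivative_eq {F : Type*} [Field F] [CharZero F] {n : ℕ} {p : F[X]}
    (hp : p ∈ degreeLT F n) : ∃ q ∈ degreeLT F (n + 1), derivative q = p := by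
  refine ⟨∑ i ∈ Finset.range n, monomial (i + 1) (p.coeff i / (i + 1)), ?_, ?_⟩
  · refine Submodule.sum_mem _ fun i hi => mem_degreeLT.2 ((degree_monomial_le _ _).trans_lt ?_)
    exact_mod_cast Nat.succ_lt_succ (Finset.mem_range.1 hi)
  · have hdeg : p.degree < n := mem_degreeLT.1 hp
    have hp' : p = ∑ i ∈ Finset.range n, monomial i (p.coeff i) := by
      rcases eq_or_ne p 0 with rfl | h0
      · simp
      · exact p.as_sum_range' n ((natDegree_lt_iff_degree_lt h0).2 hdeg)
    conv_rhs => rw [hp']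
    rw [derivative_sum]
    refine Finset.sum_congr rfl fun i _ => ?_
    rw [derivative_monomial_succ, div_mul_cancel₀ _ (Nat.cast_add_one_ne_zero i)]

/-- The real functions given by the polynomials of degree less than `n`. -/
noncomputable def polynomialFunctionsLT (n : ℕ) : Submodule ℝ (ℝ → ℝ) :=
  (degreeLT ℝ n).map (LinearMap.pi fun t => leval t)

theorem mem_polynomialFunctionsLT {n : ℕ} {g : ℝ → ℝ} :
    g ∈ polynomialFunctionsLT n ↔ ∃ p ∈ degreeLT ℝ n, ∀ t, g t = p.eval t := by
  simp [polynomialFunctionsLT, funext_iff, eq_comm]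

theorem isClosed_polynomialFunctionsLT (n : ℕ) :
    IsClosed (polynomialFunctionsLT n : Set (ℝ → ℝ)) := by
  have : FiniteDimensional ℝ (degreeLT ℝ n) := (degreeLTEquiv ℝ n).symm.finiteDimensional
  have : FiniteDimensional ℝ (polynomialFunctionsLT n) := by
    unfold polynomialFunctionsLT; infer_instance
  exact (polynomialFunctionsLT n).closed_of_finiteDimensional

theorem mem_polynomialFunctionsLT_of_iteratedDeriv_eq_zero {n : ℕ} {g : ℝ → ℝ}
    (hg : ContDiff ℝ n g) (h : ∀ t, iteratedDeriv n g t = 0) : g ∈ polynomialFunctionsLT n := by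
  induction n generalizing g with
  | zero =>
    obtain rfl : g = 0 := funext fun t => by simpa using h t
    exact zero_mem _
  | succ n ih =>
    have hd : Differentiable ℝ g := hg.differentiable (by simp)
    obtain ⟨p, hp, hgp⟩ := mem_polynomialFunctionsLT.1 <|
      ih (contDiff_succ_iff_deriv.1 hg).2.2 fun t => by rw [← iteratedDeriv_succ', h]
    obtain ⟨q, hq, rfl⟩ := exists_mem_degreeLT_derivative_eq hp
    have hconst (t : ℝ) : g t - q.eval t = g 0 - q.eval 0 :=
      is_const_of_deriv_eq_zero (f := fun t => g t - q.eval t) (hd.sub q.differentiable)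
        (fun s => by rw [deriv_fun_sub (hd s) q.differentiableAt, q.deriv, hgp, sub_self]) t 0
    refine mem_polynomialFunctionsLT.2 ⟨q + C (g 0 - q.eval 0), add_mem hq ?_, fun t => ?_⟩
    · exact mem_degreeLT.2 (degree_C_le.trans_lt (by exact_mod_cast n.succ_pos))
    · rw [eval_add, eval_C, ← hconst t, add_sub_cancel]

end Polynomials

section Ridge

variable {X : Type*} [TopologicalSpace X]

/-- The ridge function `x ↦ g (t * u x + b)` with profile `g`: for a linear form `u`, the output of
a hidden unit with activation `g`, weights `t • u` and bias `b`. -/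
def ridge (g : C(ℝ, ℝ)) (u : C(X, ℝ)) (t b : ℝ) : C(X, ℝ) :=
  g.comp (t • u + .const X b)

@[simp]
theorem ridge_apply (g : C(ℝ, ℝ)) (u : C(X, ℝ)) (t b : ℝ) (x : X) :
    ridge g u t b x = g (t * u x + b) :=
  rfl

theorem continuous_ridge (g : C(ℝ, ℝ)) (u : C(X, ℝ)) :
    Continuous fun p : ℝ × ℝ => ridge g u p.1 p.2 :=
  ContinuousMap.continuous_of_continuous_uncurry _ <| by
    simp only [Function.uncurry_def, ridge_apply]
    fun_prop

variable [CompactSpace X]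

theorem hasDerivAt_ridge {g g' : C(ℝ, ℝ)} (hg : ∀ s, HasDerivAt g (g' s) s) (u : C(X, ℝ))
    (t b : ℝ) : HasDerivAt (fun s => ridge g u s b) (u * ridge g' u t b) t := by
  have hcont : Continuous fun s => u * ridge g' u s b :=
    continuous_const.mul ((continuous_ridge g' u).comp (.prodMk_left b))
  have hftc (r : ℝ) : ridge g u r b = ridge g u t b + ∫ s in t..r, u * ridge g' u s b := by
    ext x
    have hderiv (s : ℝ) : HasDerivAt (fun s => g (s * u x + b)) (u x * g' (s * u x + b)) s := by
      have hinner : HasDerivAt (fun s => s * u x + b) (u x) s := by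
        simpa using ((hasDerivAt_id s).mul_const (u x)).add_const b
      rw [mul_comm]
      exact (hg _).comp s hinner
    have heval : (∫ s in t..r, u * ridge g' u s b) x = ∫ s in t..r, u x * g' (s * u x + b) :=
      ((ContinuousMap.evalCLM ℝ x).intervalIntegral_comp_comm
        (hcont.intervalIntegrable t r)).symm
    rw [ContinuousMap.add_apply, heval, intervalIntegral.integral_eq_sub_of_hasDerivAt
      (fun s _ => hderiv s) (Continuous.intervalIntegrable (by fun_prop) _ _)]
    simp
  rw [funext hftc]
  exact (hcont.integral_hasStrictDerivAt t t).hasDerivAt.const_add (ridge g u t b)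

theorem map_ridge_eq_zero_of_convolution {L : C(X, ℝ) →L[ℝ] ℝ} {g G : C(ℝ, ℝ)} {u : C(X, ℝ)}
    (hL : ∀ t b, L (ridge g u t b) = 0) {φ : ℝ → ℝ} (hφ : Continuous φ)
    (hφc : HasCompactSupport φ) (hG : ⇑G = φ ⋆[ContinuousLinearMap.lsmul ℝ ℝ, volume] g)
    (t b : ℝ) : L (ridge G u t b) = 0 := by
  have hcont : Continuous fun s => φ s • ridge g u t (b - s) :=
    hφ.smul ((continuous_ridge g u).comp (by fun_prop : Continuous fun s : ℝ => (t, b - s)))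
  have hint : Integrable fun s => φ s • ridge g u t (b - s) :=
    hcont.integrable_of_hasCompactSupport hφc.smul_right
  have heq : ridge G u t b = ∫ s, φ s • ridge g u t (b - s) := by
    ext x
    rw [ContinuousMap.integral_apply hint, ridge_apply, hG]
    simp [convolution_def, add_sub_assoc]
  rw [heq, ← L.integral_comp_comm hint]
  simp [hL]

theorem iteratedDeriv_mul_map_mul_pow_eq_zero {L : C(X, ℝ) →L[ℝ] ℝ} {u : C(X, ℝ)} {n : ℕ}
    {g : C(ℝ, ℝ)} (hg : ContDiff ℝ n g) {h : C(X, ℝ)} (hL : ∀ t b, L (h * ridge g u t b) = 0)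
    (b : ℝ) : iteratedDeriv n g b * L (h * u ^ n) = 0 := by
  induction n generalizing g h with
  | zero =>
    have hconst : h * ridge g u 0 b = g b • h := by ext x; simp [mul_comm]
    simpa [hconst] using hL 0 b
  | succ n ih =>
    have hg' : ContDiff ℝ n (deriv g) := (contDiff_succ_iff_deriv.1 hg).2.2
    let g' : C(ℝ, ℝ) := ⟨deriv g, hg'.continuous⟩
    have hderiv (s : ℝ) : HasDerivAt g (g' s) s :=
      (hg.differentiable (by simp) s).hasDerivAt
    have hL' (t b : ℝ) : L (h * u * ridge g' u t b) = 0 := by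
      have hd := L.hasFDerivAt.comp_hasDerivAt t ((hasDerivAt_ridge hderiv u t b).const_mul h)
      simp only [Function.comp_def, hL] at hd
      rw [mul_assoc]
      exact hd.unique (hasDerivAt_const t 0)
    rw [iteratedDeriv_succ', pow_succ', ← mul_assoc]
    exact ih hg' hL'

theorem map_pow_eq_zero_of_map_ridge {L : C(X, ℝ) →L[ℝ] ℝ} {σ : C(ℝ, ℝ)}
    (hσ : ¬ ∃ p : ℝ[X], ∀ t, σ t = p.eval t) {u : C(X, ℝ)}
    (hL : ∀ t b, L (ridge σ u t b) = 0) (n : ℕ) : L (u ^ n) = 0 := by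
  by_contra hne
  let φ (i : ℕ) : ContDiffBump (0 : ℝ) :=
    ⟨1 / (i + 1) / 2, 1 / (i + 1), by positivity, half_lt_self (by positivity)⟩
  let ψ (i : ℕ) : ℝ → ℝ := (φ i).normed volume ⋆[ContinuousLinearMap.lsmul ℝ ℝ, volume] σ
  have hψ (i : ℕ) : ContDiff ℝ n (ψ i) :=
    (φ i).hasCompactSupport_normed.contDiff_convolution_left _ (φ i).contDiff_normed
      σ.continuous.locallyIntegrable
  have hLψ (i : ℕ) (t b : ℝ) : L (1 * ridge ⟨ψ i, (hψ i).continuous⟩ u t b) = 0 := by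
    rw [one_mul]
    exact map_ridge_eq_zero_of_convolution hL (φ i).continuous_normed
      (φ i).hasCompactSupport_normed rfl t b
  have hψn (i : ℕ) : ψ i ∈ polynomialFunctionsLT n :=
    mem_polynomialFunctionsLT_of_iteratedDeriv_eq_zero (hψ i) fun b =>
      (mul_eq_zero.1 (iteratedDeriv_mul_map_mul_pow_eq_zero (hψ i) (hLψ i) b)).resolve_right
        (by rwa [one_mul])
  have hlim : Tendsto ψ atTop (𝓝 σ) := tendsto_pi_nhds.2 fun t =>
    ContDiffBump.convolution_tendsto_right_of_continuous
      tendsto_one_div_add_atTop_nhds_zero_nat σ.continuous t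
  obtain ⟨p, -, hp⟩ := mem_polynomialFunctionsLT.1 <|
    (isClosed_polynomialFunctionsLT n).mem_of_tendsto hlim (.of_forall hψn)
  exact hσ ⟨p, hp⟩

end Ridge

section Density

variable {X : Type*} [TopologicalSpace X] [CompactSpace X]

theorem dense_of_forall_dual_eq_zero {E : Type*} [NormedAddCommGroup E] [NormedSpace ℝ E]
    (V : Submodule ℝ E) (hV : ∀ L : E →L[ℝ] ℝ, (∀ v ∈ V, L v = 0) → L = 0) :
    Dense (V : Set E) := by
  intro x
  by_contra hx
  have : IsClosed (V.topologicalClosure : Set E) := V.isClosed_topologicalClosure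
  have hq : V.topologicalClosure.mkQL x ≠ 0 := mt (Submodule.Quotient.mk_eq_zero _).1 hx
  obtain ⟨f, hf⟩ := SeparatingDual.exists_ne_zero (R := ℝ) hq
  refine hf (DFunLike.congr_fun (hV (f.comp V.topologicalClosure.mkQL) fun v hv => ?_) x)
  have hv0 : V.topologicalClosure.mkQL v = 0 :=
    (Submodule.Quotient.mk_eq_zero _).2 (V.le_topologicalClosure hv)
  rw [ContinuousLinearMap.comp_apply, hv0, map_zero]

theorem map_exp_eq_zero_of_map_pow {A : Type*} [NormedRing A] [NormedAlgebra ℝ A] [CompleteSpace A]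
    {L : A →L[ℝ] ℝ} {a : A} (hL : ∀ n, L (a ^ n) = 0) : L (NormedSpace.exp a) = 0 := by
  have hsum := (NormedSpace.exp_series_hasSum_exp' (𝕂 := ℝ) a).mapL L
  simp only [map_smul, hL, smul_zero] at hsum
  exact hsum.unique hasSum_zero

theorem exp_apply (u : C(X, ℝ)) (x : X) : NormedSpace.exp u x = Real.exp (u x) := by
  rw [Real.exp_eq_exp_ℝ]
  exact NormedSpace.map_exp (ContinuousMap.evalAlgHom ℝ ℝ x)
    (ContinuousMap.evalCLM ℝ x).continuous u

variable {E : Type*} [AddCommGroup E] [Module ℝ E]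

theorem eq_zero_of_map_exp {ℓ : E →ₗ[ℝ] C(X, ℝ)} (hℓ : ∀ x y, x ≠ y → ∃ w, ℓ w x ≠ ℓ w y)
    {L : C(X, ℝ) →L[ℝ] ℝ} (hL : ∀ w, L (NormedSpace.exp (ℓ w)) = 0) : L = 0 := by
  let M : Submonoid C(X, ℝ) :=
    { carrier := Set.range fun w => NormedSpace.exp (ℓ w)
      one_mem' := ⟨0, by simp⟩
      mul_mem' := by
        rintro _ _ ⟨w, rfl⟩ ⟨w', rfl⟩
        exact ⟨w + w', by simp only [map_add, NormedSpace.exp_add]⟩ }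
  let A : Subalgebra ℝ C(X, ℝ) := Algebra.adjoin ℝ M
  have hsep : A.SeparatesPoints := fun x y hxy => by
    obtain ⟨w, hw⟩ := hℓ x y hxy
    exact ⟨_, ⟨NormedSpace.exp (ℓ w), Algebra.subset_adjoin ⟨w, rfl⟩, rfl⟩, by simpa [exp_apply]⟩
  have hA : (A : Set C(X, ℝ)) ⊆ L.ker := by
    have hspan : Subalgebra.toSubmodule A ≤ L.ker := by
      rw [Algebra.adjoin_eq_span, Submonoid.closure_eq, Submodule.span_le]
      rintro _ ⟨w, rfl⟩
      exact hL w
    exact hspan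
  ext a
  have ha : a ∈ A.topologicalClosure := by
    rw [ContinuousMap.subalgebra_topologicalClosure_eq_top_of_separatesPoints A hsep]
    exact Algebra.mem_top
  exact closure_minimal hA L.isClosed_ker ha

theorem dense_span_ridge {ℓ : E →ₗ[ℝ] C(X, ℝ)} (hℓ : ∀ x y, x ≠ y → ∃ w, ℓ w x ≠ ℓ w y)
    {σ : C(ℝ, ℝ)} (hσ : ¬ ∃ p : ℝ[X], ∀ t, σ t = p.eval t) :
    Dense (Submodule.span ℝ (Set.range fun q : E × ℝ => ridge σ (ℓ q.1) 1 q.2) :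
      Set C(X, ℝ)) := by
  refine dense_of_forall_dual_eq_zero _ fun L hL => eq_zero_of_map_exp hℓ fun w =>
    map_exp_eq_zero_of_map_pow (map_pow_eq_zero_of_map_ridge hσ fun t b => ?_)
  have hridge : ridge σ (ℓ (t • w)) 1 b = ridge σ (ℓ w) t b := by ext x; simp
  rw [← hridge]
  exact hL _ (Submodule.subset_span ⟨(t • w, b), rfl⟩)

/-- The linear forms on `ι → ℝ` as continuous functions on `D`. -/
def linearForms {ι : Type*} [Fintype ι] (D : Set (ι → ℝ)) : (ι → ℝ) →ₗ[ℝ] C(D, ℝ) where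
  toFun w := ⟨fun z => w ⬝ᵥ z, by fun_prop⟩
  map_add' w w' := by ext z; exact add_dotProduct w w' z
  map_smul' c w := by ext z; exact smul_dotProduct c w z

theorem exists_mlp_approx {ι : Type} [Fintype ι] {D : Set (ι → ℝ)} (hD : IsCompact D) {σ : ℝ → ℝ}
    (hσ : Continuous σ) (hσp : ¬ ∃ p : ℝ[X], ∀ t, σ t = p.eval t) (Φ : C(D, ℝ)) {ε : ℝ}
    (hε : 0 < ε) : ∃ N : MLP ι, ∀ z : D, |N.eval σ z - Φ z| < ε := by
  have : CompactSpace D := isCompact_iff_compactSpace.1 hD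
  have hsep (x y : D) (hxy : x ≠ y) : ∃ w, linearForms D w x ≠ linearForms D w y := by
    by_contra! h
    refine hxy (Subtype.ext (dotProduct_eq _ _ fun w => ?_))
    rw [dotProduct_comm _ w, dotProduct_comm _ w]
    exact h w
  obtain ⟨a, ha, hdist⟩ := (dense_span_ridge hsep (σ := ⟨σ, hσ⟩) hσp).exists_dist_lt Φ hε
  obtain ⟨c, rfl⟩ := Finsupp.mem_span_range_iff_exists_finsupp.1 ha
  let e := c.support.equivFin
  refine ⟨.shallow (fun i => (e.symm i).1.1) (fun i => (e.symm i).1.2) (fun i => c (e.symm i)) 0,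
    fun z => ?_⟩
  have hz := (ContinuousMap.dist_lt_iff hε).1 hdist z
  rw [Real.dist_eq, abs_sub_comm] at hz
  convert hz using 3
  rw [Finsupp.sum, ContinuousMap.coe_sum, Finset.sum_apply, ← Finset.sum_coe_sort c.support,
    ← e.symm.sum_comp]
  simp [MLP.eval, linearForms, Matrix.mulVec]

end Density

section Limits

theorem eventually_le_iff_of_tendsto {α R : Type*} [LinearOrder R] [TopologicalSpace R]
    [OrderClosedTopology R] {l : Filter α} {f g : α → R} {a b : R} (hf : Tendsto f l (𝓝 a))
    (hg : Tendsto g l (𝓝 b)) (hab : a ≠ b) : ∀ᶠ x in l, (f x ≤ g x ↔ a ≤ b) := by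
  rcases hab.lt_or_gt with h | h
  · filter_upwards [hf.eventually_lt hg h] with x hx using iff_of_true hx.le h.le
  · filter_upwards [hg.eventually_lt hf h] with x hx using iff_of_false hx.not_ge h.not_ge

theorem tendsto_setIntegral_of_ae_eventually_mem_iff {α ι E : Type*} [MeasurableSpace α]
    [NormedAddCommGroup E] [NormedSpace ℝ E] {μ : Measure α} {l : Filter ι}
    [l.IsCountablyGenerated] {f : α → E} (hf : Integrable f μ) {s : ι → Set α} {t : Set α}
    (hs : ∀ i, MeasurableSet (s i)) (ht : MeasurableSet t)
    (hst : ∀ᵐ a ∂μ, ∀ᶠ i in l, (a ∈ s i ↔ a ∈ t)) :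
    Tendsto (fun i => ∫ a in s i, f a ∂μ) l (𝓝 (∫ a in t, f a ∂μ)) := by
  simp only [← integral_indicator (hs _), ← integral_indicator ht]
  refine tendsto_integral_filter_of_dominated_convergence (fun a => ‖f a‖)
    (.of_forall fun i => hf.aestronglyMeasurable.indicator (hs i))
    (.of_forall fun i => .of_forall fun a => norm_indicator_le_norm_self f a) hf.norm ?_
  filter_upwards [hst] with a ha
  refine tendsto_const_nhds.congr' ?_
  filter_upwards [ha] with i hi using Set.indicator_eq_indicator hi.symm rfl

theorem addHaar_linearMap_eq_const {E : Type*} [NormedAddCommGroup E] [NormedSpace ℝ E]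
    [FiniteDimensional ℝ E] [MeasurableSpace E] [BorelSpace E] (μ : Measure E) [μ.IsAddHaarMeasure]
    {φ : E →ₗ[ℝ] ℝ} (hφ : φ ≠ 0) (c : ℝ) : μ {e | φ e = c} = 0 := by
  let s : AffineSubspace ℝ E := (AffineSubspace.mk' c ⊥).comap φ.toAffineMap
  have hs : (s : Set E) = {e | φ e = c} := by
    ext e
    simp [s, sub_eq_zero]
  rw [← hs]
  refine Measure.addHaar_affineSubspace μ s fun htop => hφ (LinearMap.ext fun e => ?_)
  have hall (e : E) : φ e = c := by
    have he : e ∈ (s : Set E) := htop ▸ AffineSubspace.mem_top ℝ E e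
    rwa [hs] at he
  rw [hall e, ← hall 0, map_zero, LinearMap.zero_apply]

end Limits

variable {K : ℕ}

section Sqrt

open scoped MatrixOrder Matrix.Norms.L2Operator

theorem continuousOn_sqrtMatrix :
    ContinuousOn sqrtMatrix {S : Matrix (Fin K) (Fin K) ℝ | S.PosSemidef} :=
  (CFC.continuousOn_sqrt (A := Matrix (Fin K) (Fin K) ℝ)).mono fun _ hS => hS.nonneg

theorem sqrtMatrix_mul_self {S : Matrix (Fin K) (Fin K) ℝ} (hS : S.PosSemidef) :
    sqrtMatrix S * sqrtMatrix S = S :=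
  CFC.sqrt_mul_sqrt_self S hS.nonneg

theorem posSemidef_sqrtMatrix (S : Matrix (Fin K) (Fin K) ℝ) : (sqrtMatrix S).PosSemidef :=
  Matrix.nonneg_iff_posSemidef.1 (CFC.sqrt_nonneg S)

theorem sqrtMatrix_submatrix {S : Matrix (Fin K) (Fin K) ℝ} (hS : S.PosSemidef)
    (π : Equiv.Perm (Fin K)) :
    sqrtMatrix (S.submatrix π π) = (sqrtMatrix S).submatrix π π :=
  CFC.sqrt_unique (by rw [Matrix.submatrix_mul_equiv, sqrtMatrix_mul_self hS])
    ((posSemidef_sqrtMatrix S).submatrix π).nonneg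

theorem sqrtMatrix_dotProduct {S : Matrix (Fin K) (Fin K) ℝ} (hS : S.PosSemidef) (k l : Fin K) :
    sqrtMatrix S k ⬝ᵥ sqrtMatrix S l = S k l := by
  have hsymm : (sqrtMatrix S).IsSymm :=
    Matrix.isHermitian_iff_isSymm.1 (posSemidef_sqrtMatrix S).isHermitian
  calc sqrtMatrix S k ⬝ᵥ sqrtMatrix S l
      = (sqrtMatrix S * (sqrtMatrix S)ᵀ) k l := rfl
    _ = S k l := by rw [hsymm.eq, sqrtMatrix_mul_self hS]

end Sqrt

section ChoiceProb

theorem utility_submatrix {S : Matrix (Fin K) (Fin K) ℝ} (hS : S.PosSemidef)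
    (π : Equiv.Perm (Fin K)) (v e : Fin K → ℝ) (k : Fin K) :
    utility (v ∘ π) (S.submatrix π π) (e ∘ π) k = utility v S e (π k) := by
  simp only [utility, sqrtMatrix_submatrix hS, Function.comp_apply, Matrix.submatrix_mulVec_equiv,
    Function.comp_assoc, Equiv.self_comp_symm, Function.comp_id]

theorem mem_choiceRegion_submatrix {S : Matrix (Fin K) (Fin K) ℝ} (hS : S.PosSemidef)
    (π : Equiv.Perm (Fin K)) (v e : Fin K → ℝ) (j : Fin K) :
    e ∘ π ∈ choiceRegion j (v ∘ π) (S.submatrix π π) ↔ e ∈ choiceRegion (π j) v S := by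
  simp only [choiceRegion, Set.mem_ofPred_eq, utility_submatrix hS, ← π.injective.ne_iff (y := j)]
  exact π.forall_congr_right (q := fun k => k ≠ π j → utility v S e k ≤ utility v S e (π j))

theorem choiceProb_submatrix {f : (Fin K → ℝ) → ℝ}
    (hf : ∀ (π : Equiv.Perm (Fin K)) (e : Fin K → ℝ), f (e ∘ π) = f e) (j : Fin K)
    (v : Fin K → ℝ) {S : Matrix (Fin K) (Fin K) ℝ} (hS : S.PosSemidef)
    (π : Equiv.Perm (Fin K)) :
    choiceProb f j (v ∘ π) (S.submatrix π π) = choiceProb f (π j) v S := by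
  let T : (Fin K → ℝ) ≃ᵐ (Fin K → ℝ) := MeasurableEquiv.piCongrLeft (fun _ => ℝ) π.symm
  have hT (e : Fin K → ℝ) : T e = e ∘ π := by
    ext k
    have h := Equiv.piCongrLeft_apply_apply (fun _ => ℝ) π.symm e (π k)
    rwa [π.symm_apply_apply] at h
  have hpre : T ⁻¹' choiceRegion j (v ∘ π) (S.submatrix π π) = choiceRegion (π j) v S := by
    ext e
    rw [Set.mem_preimage, hT, mem_choiceRegion_submatrix hS]
  have hmp : MeasurePreserving T := volume_measurePreserving_piCongrLeft (fun _ => ℝ) π.symm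
  calc choiceProb f j (v ∘ π) (S.submatrix π π)
      = ∫ e in choiceRegion (π j) v S, f (T e) := by
        rw [choiceProb, ← hmp.setIntegral_preimage_emb T.measurableEmbedding, hpre]
    _ = choiceProb f (π j) v S := by simp only [hT, hf, choiceProb]

theorem measurableSet_choiceRegion (j : Fin K) (v : Fin K → ℝ) (S : Matrix (Fin K) (Fin K) ℝ) :
    MeasurableSet (choiceRegion j v S) := by
  have hutility (k : Fin K) : Measurable fun e => utility v S e k := by
    unfold utility Matrix.mulVec dotProduct
    fun_prop
  simp only [choiceRegion, Set.ofPred_forall]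
  exact .iInter fun k => .iInter fun _ => measurableSet_le (hutility k) (hutility j)

theorem continuousOn_utility (e : Fin K → ℝ) (k : Fin K) :
    ContinuousOn (fun x : (Fin K → ℝ) × Matrix (Fin K) (Fin K) ℝ => utility x.1 x.2 e k)
      {x | x.2.PosSemidef} := by
  have hmulVec : Continuous fun A : Matrix (Fin K) (Fin K) ℝ => (A *ᵥ e) k := by fun_prop
  have hsqrt : ContinuousOn (fun x : (Fin K → ℝ) × Matrix (Fin K) (Fin K) ℝ => sqrtMatrix x.2)
      {x | x.2.PosSemidef} := continuousOn_sqrtMatrix.comp continuousOn_snd fun _ hx => hx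
  have hfst : ContinuousOn (fun x : (Fin K → ℝ) × Matrix (Fin K) (Fin K) ℝ => x.1 k)
      {x | x.2.PosSemidef} := by fun_prop
  exact hfst.add (hmulVec.comp_continuousOn hsqrt)

theorem ae_utility_ne {j : Fin K} {x : (Fin K → ℝ) × Matrix (Fin K) (Fin K) ℝ}
    (hx : x ∈ choiceDomain j) {k : Fin K} (hk : k ≠ j) :
    ∀ᵐ e : Fin K → ℝ, utility x.1 x.2 e k ≠ utility x.1 x.2 e j := by
  set A := sqrtMatrix x.2 with hA
  let φ : (Fin K → ℝ) →ₗ[ℝ] ℝ := dotProductBilin ℝ ℝ (A k - A j)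
  have htie (e : Fin K → ℝ) :
      utility x.1 x.2 e k = utility x.1 x.2 e j ↔ φ e = x.1 j - x.1 k := by
    simp only [utility, Matrix.mulVec, ← hA, φ, dotProductBilin_apply_apply, sub_dotProduct]
    constructor <;> intro h <;> linarith
  simp only [ne_eq, htie]
  by_cases hφ : φ = 0
  · have hrow : A k = A j := sub_eq_zero.1 <| dotProduct_eq_zero _ fun e => by
      simpa [φ] using LinearMap.congr_fun hφ e
    have hv : x.1 j - x.1 k ≠ 0 := fun hv => hx.2 k hk ⟨(sub_eq_zero.1 hv).symm, by
      rw [← sqrtMatrix_dotProduct hx.1, ← sqrtMatrix_dotProduct hx.1 k,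
        ← sqrtMatrix_dotProduct hx.1 j k, ← hA, hrow]
      ring⟩
    simp [hφ, hv.symm]
  · exact ae_iff.2 (by simpa using addHaar_linearMap_eq_const volume hφ (x.1 j - x.1 k))

theorem continuousOn_choiceProb {f : (Fin K → ℝ) → ℝ} (hf : Integrable f) (j : Fin K) :
    ContinuousOn (fun x => choiceProb f j x.1 x.2) (choiceDomain j) := by
  have : FirstCountableTopology (Matrix (Fin K) (Fin K) ℝ) :=
    inferInstanceAs (FirstCountableTopology (Fin K → Fin K → ℝ))
  intro x hx
  refine tendsto_setIntegral_of_ae_eventually_mem_iff hf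
    (fun y => measurableSet_choiceRegion j y.1 y.2) (measurableSet_choiceRegion j x.1 x.2) ?_
  have hlim (e : Fin K → ℝ) (k : Fin K) :=
    ((continuousOn_utility e k).mono fun y (hy : y ∈ choiceDomain j) => hy.1) x hx
  have hne : ∀ᵐ e : Fin K → ℝ, ∀ k, k ≠ j → utility x.1 x.2 e k ≠ utility x.1 x.2 e j :=
    ae_all_iff.2 fun k => ae_all_iff.2 fun hk => ae_utility_ne hx hk
  filter_upwards [hne] with e he
  have hev : ∀ᶠ y in 𝓝[choiceDomain j] x, ∀ k, k ≠ j →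
      (utility y.1 y.2 e k ≤ utility y.1 y.2 e j ↔ utility x.1 x.2 e k ≤ utility x.1 x.2 e j) :=
    eventually_all.2 fun k => eventually_all.2 fun hk =>
      eventually_le_iff_of_tendsto (hlim e k) (hlim e j) (he k hk)
  filter_upwards [hev] with y hy
  exact forall₂_congr hy

end ChoiceProb

section Positions

/-- The off-diagonal position above the diagonal with row and column labels `k` and `l`. -/
def position (k l : Fin K) : Fin K × Fin K :=
  (min k l, max k l)

theorem position_comm (k l : Fin K) : position k l = position l k := by
  rw [position, position, min_comm, max_comm]

theorem position_right_injective (k : Fin K) : Function.Injective (position k) := by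
  intro a b hab
  simp only [position, Prod.mk.injEq] at hab
  grind

theorem position_mem_offPositions {j k l : Fin K} (hk : k ≠ j) (hl : l ≠ j) (hkl : k ≠ l) :
    position k l ∈ offPositions j := by
  simp only [offPositions, Finset.mem_filter, Finset.mem_univ, true_and, position]
  grind

theorem matrix_apply_position {Y : Matrix (Fin K) (Fin K) ℝ} (hY : Y.IsSymm) (k l : Fin K) :
    Y (position k l).1 (position k l).2 = Y k l := by
  rcases le_total k l with h | h
  · simp [position, h]
  · simp [position, h, hY.apply]

/-- The row of `k`: the off-diagonal positions away from `j` whose row or column is `k`. -/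
def rowPositions (j k : Fin K) : Finset (Fin K × Fin K) :=
  ((others j).erase k).image (position k)

theorem mem_others {j k : Fin K} : k ∈ others j ↔ k ≠ j := by
  simp [others]

theorem position_mem_rowPositions {j k l : Fin K} (hl : l ≠ j) (hkl : k ≠ l) :
    position k l ∈ rowPositions j k :=
  Finset.mem_image_of_mem _ (Finset.mem_erase.2 ⟨hkl.symm, mem_others.2 hl⟩)

theorem eq_position_of_mem_rowPositions {j k l : Fin K} (hkl : k ≠ l) {p : Fin K × Fin K}
    (hk : p ∈ rowPositions j k) (hl : p ∈ rowPositions j l) : p = position k l := by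
  obtain ⟨a, -, rfl⟩ := Finset.mem_image.1 hk
  obtain ⟨b, -, hab⟩ := Finset.mem_image.1 hl
  simp only [position, Prod.mk.injEq] at hab ⊢
  grind

theorem rowPositions_subset {j k : Fin K} (hk : k ≠ j) : rowPositions j k ⊆ offPositions j := by
  intro p hp
  obtain ⟨l, hl, rfl⟩ := Finset.mem_image.1 hp
  obtain ⟨hlk, hlj⟩ := Finset.mem_erase.1 hl
  exact position_mem_offPositions hk (mem_others.1 hlj) hlk.symm

theorem card_rowPositions {j k : Fin K} (hk : k ≠ j) : (rowPositions j k).card = K - 2 := by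
  have hothers : (others j).card = K - 1 := by
    rw [others, Finset.filter_ne', Finset.card_erase_of_mem (Finset.mem_univ j), Finset.card_univ,
      Fintype.card_fin]
  rw [rowPositions, Finset.card_image_of_injective _ (position_right_injective k),
    Finset.card_erase_of_mem (mem_others.2 hk), hothers, Nat.sub_sub]

end Positions

section Identification

/-- The space `𝒳_K` without its trace normalization. -/
structure IsCentered (x : (Fin K → ℝ) × Matrix (Fin K) (Fin K) ℝ) : Prop where
  isSymm : x.2.IsSymm
  sum_eq_zero : ∑ i, x.1 i = 0
  mulVec_one_eq_zero : x.2.mulVec (fun _ => 1) = 0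

/-- Genericity condition (b): the off-diagonal entries away from `j` that lie in row `k` are
singled out among all off-diagonal entries away from `j` by their number and their sum. -/
def HasUniqueRowPositions (j : Fin K) (Y : Matrix (Fin K) (Fin K) ℝ) : Prop :=
  ∀ k, k ≠ j → ∃! T : Finset (Fin K × Fin K),
    T ⊆ offPositions j ∧ T.card = K - 2 ∧ ∑ p ∈ T, Y p.1 p.2 = -Y k k - Y j k

theorem isCentered_of_mem_centeredSpace {x : (Fin K → ℝ) × Matrix (Fin K) (Fin K) ℝ}
    (hx : x ∈ centeredSpace K) : IsCentered x :=
  ⟨hx.1, hx.2.1, hx.2.2.1⟩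

theorem hasUniqueRowPositions_of_notMem_exceptionalSet {j : Fin K}
    {x : (Fin K → ℝ) × Matrix (Fin K) (Fin K) ℝ} (hx : x ∈ centeredSpace K \ exceptionalSet j) :
    HasUniqueRowPositions j x.2 :=
  (not_not.1 fun h => hx.2 ⟨hx.1, h⟩).2

theorem IsCentered.row_sum_eq_zero {x : (Fin K → ℝ) × Matrix (Fin K) (Fin K) ℝ} (hx : IsCentered x)
    (k : Fin K) : ∑ l, x.2 k l = 0 := by
  simpa [Matrix.mulVec, dotProduct] using congrFun hx.mulVec_one_eq_zero k

theorem IsCentered.sum_rowPositions {x : (Fin K → ℝ) × Matrix (Fin K) (Fin K) ℝ} (hx : IsCentered x)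
    {j k : Fin K} (hk : k ≠ j) : ∑ p ∈ rowPositions j k, x.2 p.1 p.2 = -x.2 k k - x.2 j k := by
  rw [rowPositions, Finset.sum_image (position_right_injective k).injOn]
  simp only [matrix_apply_position hx.isSymm]
  have hrow := hx.row_sum_eq_zero k
  rw [← Finset.add_sum_erase _ _ (Finset.mem_univ j), ← Finset.filter_ne', ← others,
    ← Finset.add_sum_erase _ _ (mem_others.2 hk), hx.isSymm.apply] at hrow
  linarith

theorem apply_eq_of_sum_eq {ι M : Type*} [Fintype ι] [AddCancelCommMonoid M] {a b : ι → M}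
    (h : ∑ i, a i = ∑ i, b i) {j : ι} (hab : ∀ k, k ≠ j → a k = b k) : a j = b j := by
  classical
  rw [← Finset.add_sum_erase _ a (Finset.mem_univ j),
    ← Finset.add_sum_erase _ b (Finset.mem_univ j),
    Finset.sum_congr rfl fun k hk => hab k (Finset.ne_of_mem_erase hk)] at h
  exact add_right_cancel h

/-- The unordered data of `x` and `y` agree: `π` matches the triples, and `ρ` the off-diagonal
entries away from `j`. A priori `ρ` need not be induced by `π`. -/
structure IsRearrangement (j : Fin K) (x y : (Fin K → ℝ) × Matrix (Fin K) (Fin K) ℝ)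
    (π : Equiv.Perm (Fin K)) (ρ : Equiv.Perm (Fin K × Fin K)) : Prop where
  apply_self : π j = j
  triple_eq : ∀ k, k ≠ j → triple j y k = triple j x (π k)
  apply_mem : ∀ p ∈ offPositions j, ρ p ∈ offPositions j
  entry_eq : ∀ p ∈ offPositions j, y.2 p.1 p.2 = x.2 (ρ p).1 (ρ p).2

namespace IsRearrangement

variable {j : Fin K} {x y : (Fin K → ℝ) × Matrix (Fin K) (Fin K) ℝ} {π : Equiv.Perm (Fin K)}
  {ρ : Equiv.Perm (Fin K × Fin K)}

theorem apply_ne (h : IsRearrangement j x y π ρ) {k : Fin K} (hk : k ≠ j) : π k ≠ j :=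
  fun hkj => hk (π.injective (hkj.trans h.apply_self.symm))

theorem components_eq (h : IsRearrangement j x y π ρ) {k : Fin K} (hk : k ≠ j) :
    y.1 k = x.1 (π k) ∧ y.2 k k = x.2 (π k) (π k) ∧ y.2 j k = x.2 j (π k) := by
  simpa [triple] using h.triple_eq k hk

theorem fst_eq (h : IsRearrangement j x y π ρ) (hx : IsCentered x) (hy : IsCentered y) :
    y.1 = x.1 ∘ π := by
  have hne (k : Fin K) (hk : k ≠ j) : y.1 k = x.1 (π k) := (h.components_eq hk).1
  have hsum : ∑ i, y.1 i = ∑ i, x.1 (π i) := by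
    rw [Equiv.sum_comp, hx.sum_eq_zero, hy.sum_eq_zero]
  funext k
  by_cases hk : k = j
  · exact hk ▸ apply_eq_of_sum_eq hsum hne
  · exact hne k hk

theorem row_eq (h : IsRearrangement j x y π ρ) (hx : IsCentered x) (hy : IsCentered y)
    (k : Fin K) : y.2 j k = x.2 j (π k) := by
  have hne (k : Fin K) (hk : k ≠ j) : y.2 j k = x.2 j (π k) := (h.components_eq hk).2.2
  have hsum : ∑ i, y.2 j i = ∑ i, x.2 j (π i) := by
    rw [Equiv.sum_comp π (x.2 j), hx.row_sum_eq_zero, hy.row_sum_eq_zero]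
  by_cases hk : k = j
  · exact hk ▸ apply_eq_of_sum_eq hsum hne
  · exact hne k hk

theorem image_rowPositions (h : IsRearrangement j x y π ρ) (hx : IsCentered x) (hy : IsCentered y)
    (hxj : HasUniqueRowPositions j x.2) {k : Fin K} (hk : k ≠ j) :
    (rowPositions j k).image ρ = rowPositions j (π k) := by
  have hπk : π k ≠ j := h.apply_ne hk
  have hsum : ∑ p ∈ (rowPositions j k).image ρ, x.2 p.1 p.2 = -x.2 (π k) (π k) - x.2 j (π k) := by
    obtain ⟨-, hdiag, hrow⟩ := h.components_eq hk
    rw [Finset.sum_image ρ.injective.injOn, ← hdiag, ← hrow, ← hy.sum_rowPositions hk]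
    exact Finset.sum_congr rfl fun p hp => (h.entry_eq p (rowPositions_subset hk hp)).symm
  refine (hxj (π k) hπk).unique ⟨?_, ?_, hsum⟩
    ⟨rowPositions_subset hπk, card_rowPositions hπk, hx.sum_rowPositions hπk⟩
  · exact Finset.image_subset_iff.2 fun p hp => h.apply_mem p (rowPositions_subset hk hp)
  · rw [Finset.card_image_of_injective _ ρ.injective, card_rowPositions hk]

theorem apply_position (h : IsRearrangement j x y π ρ) (hx : IsCentered x) (hy : IsCentered y)
    (hxj : HasUniqueRowPositions j x.2) {k l : Fin K} (hk : k ≠ j) (hl : l ≠ j) (hkl : k ≠ l) :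
    ρ (position k l) = position (π k) (π l) := by
  refine eq_position_of_mem_rowPositions (j := j) (π.injective.ne hkl) ?_ ?_
  · rw [← h.image_rowPositions hx hy hxj hk]
    exact Finset.mem_image_of_mem _ (position_mem_rowPositions hl hkl)
  · rw [← h.image_rowPositions hx hy hxj hl, position_comm]
    exact Finset.mem_image_of_mem _ (position_mem_rowPositions hk hkl.symm)

theorem snd_eq (h : IsRearrangement j x y π ρ) (hx : IsCentered x) (hy : IsCentered y)
    (hxj : HasUniqueRowPositions j x.2) : y.2 = x.2.submatrix π π := by
  ext k l
  rw [Matrix.submatrix_apply]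
  by_cases hk : k = j
  · rw [hk, h.apply_self, h.row_eq hx hy]
  by_cases hl : l = j
  · rw [hl, h.apply_self, ← hy.isSymm.apply, ← hx.isSymm.apply, h.row_eq hx hy]
  by_cases hkl : k = l
  · rw [hkl, (h.components_eq hl).2.1]
  have hentry := h.entry_eq _ (position_mem_offPositions hk hl hkl)
  rwa [h.apply_position hx hy hxj hk hl hkl, matrix_apply_position hy.isSymm,
    matrix_apply_position hx.isSymm] at hentry

end IsRearrangement

end Identification

section Enumerations

theorem exists_equiv_sort_map_eq_ofFn {α β : Type*} [LinearOrder β] (s : Finset α) (g : α → β) :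
    ∃ e : Fin s.card ≃ s, (s.val.map g).sort (· ≤ ·) = List.ofFn fun i => g (e i) := by
  let e : Fin s.card ≃ s := (Tuple.sort fun i => g (s.equivFin.symm i)).trans s.equivFin.symm
  have hmono : Monotone fun i => g (e i) := Tuple.monotone_sort fun i => g (s.equivFin.symm i)
  have he : Finset.univ.map (e.toEmbedding.trans (.subtype _)) = s := by
    rw [← Finset.map_map, Finset.map_univ_equiv, Finset.univ_eq_attach, Finset.attach_map_val]
  refine ⟨e, List.Perm.eq_of_pairwise' (Multiset.pairwise_sort _ _) hmono.sortedLE_ofFn.pairwise ?_⟩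
  rw [← Multiset.coe_eq_coe, Multiset.sort_eq, ← Fin.univ_val_map]
  conv_lhs => rw [← he]
  rw [Finset.map_val, Multiset.map_map]
  rfl

/-- A way of listing the alternatives other than `j` and the off-diagonal positions away from
`j`. -/
abbrev Enumeration (j : Fin K) : Type :=
  (Fin (others j).card ≃ others j) × (Fin (offPositions j).card ≃ offPositions j)

/-- The components of `g_j`, listed along the enumeration `q` instead of being sorted. -/
def enumeratedFeatures {j : Fin K} (q : Enumeration j)
    (x : (Fin K → ℝ) × Matrix (Fin K) (Fin K) ℝ) : FeatureIndex j → ℝ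
  | Sum.inl (i, c) => ![x.1 (q.1 i), x.2 (q.1 i) (q.1 i), x.2 j (q.1 i)] c
  | Sum.inr i => x.2 (q.2 i).1.1 (q.2 i).1.2

theorem continuous_enumeratedFeatures {j : Fin K} (q : Enumeration j) :
    Continuous (enumeratedFeatures q) := by
  refine continuous_pi fun a => ?_
  rcases a with ⟨i, c⟩ | i
  · fin_cases c
    · exact (continuous_apply (q.1 i).1).comp continuous_fst
    · exact continuous_snd.matrix_elem _ _
    · exact continuous_snd.matrix_elem _ _
  · simp only [enumeratedFeatures]
    fun_prop

theorem exists_features_eq (j : Fin K) (x : (Fin K → ℝ) × Matrix (Fin K) (Fin K) ℝ) :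
    ∃ q : Enumeration j, features j x = enumeratedFeatures q x := by
  obtain ⟨τ, hτ⟩ := exists_equiv_sort_map_eq_ofFn (others j) (triple j x)
  obtain ⟨ρ, hρ⟩ := exists_equiv_sort_map_eq_ofFn (offPositions j) fun p => x.2 p.1 p.2
  refine ⟨(τ, ρ), funext ?_⟩
  rintro (⟨i, c⟩ | i)
  · have htriple : sortedTriple j x i = triple j x (τ i) := by
      simp only [sortedTriple, tripleMultiset, hτ, List.getElem_ofFn]
    simp only [features, enumeratedFeatures, htriple]
    rfl
  · simp only [features, enumeratedFeatures, sortedOff, offMultiset, hρ, List.getElem_ofFn]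

theorem exists_isRearrangement_of_enumeratedFeatures_eq {j : Fin K} {q r : Enumeration j}
    {x y : (Fin K → ℝ) × Matrix (Fin K) (Fin K) ℝ}
    (h : enumeratedFeatures q x = enumeratedFeatures r y) :
    ∃ π ρ, IsRearrangement j x y π ρ := by
  have htriple (i : Fin (others j).card) : triple j y (r.1 i) = triple j x (q.1 i) := by
    have hv := congrFun h (Sum.inl (i, 0))
    have hdiag := congrFun h (Sum.inl (i, 1))
    have hrow := congrFun h (Sum.inl (i, 2))
    simp only [enumeratedFeatures, Matrix.cons_val] at hv hdiag hrow
    simp only [triple, hv, hdiag, hrow]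
  refine ⟨.ofSubtype (r.1.symm.trans q.1), .ofSubtype (r.2.symm.trans q.2), ?_, ?_, ?_, ?_⟩
  · exact Equiv.Perm.ofSubtype_apply_of_not_mem _ (by simp [mem_others])
  · intro k hk
    rw [Equiv.Perm.ofSubtype_apply_of_mem _ (mem_others.2 hk)]
    simpa using htriple (r.1.symm ⟨k, mem_others.2 hk⟩)
  · intro p hp
    rw [Equiv.Perm.ofSubtype_apply_of_mem _ hp]
    exact Subtype.coe_prop _
  · intro p hp
    rw [Equiv.Perm.ofSubtype_apply_of_mem _ hp]
    simpa [enumeratedFeatures] using (congrFun h (Sum.inr (r.2.symm ⟨p, hp⟩))).symm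

end Enumerations

section Factorization

theorem exists_continuousMap_range_apply_eq {X Y Z : Type*} [TopologicalSpace X] [CompactSpace X]
    [TopologicalSpace Y] [T2Space Y] [TopologicalSpace Z] {F : X → Y} (hF : Continuous F)
    {P : X → Z} (hP : Continuous P) (hPF : P.FactorsThrough F) :
    ∃ Φ : C(Set.range F, Z), ∀ a, Φ ⟨F a, a, rfl⟩ = P a := by
  let G : C(X, Set.range F) := ⟨Set.rangeFactorization F, hF.subtype_mk _⟩
  have hG : Topology.IsQuotientMap G :=
    .of_surjective_continuous Set.rangeFactorization_surjective G.continuous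
  have hPG : Function.FactorsThrough P G := fun a b hab => hPF (congrArg Subtype.val hab)
  exact ⟨hG.lift ⟨P, hP⟩ hPG, fun a => DFunLike.congr_fun (hG.lift_comp ⟨P, hP⟩ hPG) a⟩

end Factorization

theorem IsExchangeableDensity.integrable {f : (Fin K → ℝ) → ℝ} (hf : IsExchangeableDensity f) :
    Integrable f := by
  refine ⟨hf.measurable.aestronglyMeasurable, ?_⟩
  rw [hasFiniteIntegral_iff_ofReal (.of_forall hf.nonneg), hf.lintegral_eq_one]
  exact ENNReal.one_lt_top

theorem choiceProb_eq_of_isRearrangement {f : (Fin K → ℝ) → ℝ}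
    (hf : ∀ (π : Equiv.Perm (Fin K)) (e : Fin K → ℝ), f (e ∘ π) = f e) {j : Fin K}
    {x y : (Fin K → ℝ) × Matrix (Fin K) (Fin K) ℝ} {π : Equiv.Perm (Fin K)}
    {ρ : Equiv.Perm (Fin K × Fin K)} (h : IsRearrangement j x y π ρ) (hx : IsCentered x)
    (hy : IsCentered y) (hxj : HasUniqueRowPositions j x.2) (hxpos : x.2.PosSemidef) :
    choiceProb f j x.1 x.2 = choiceProb f j y.1 y.2 := by
  rw [h.fst_eq hx hy, h.snd_eq hx hy hxj, choiceProb_submatrix hf j x.1 hxpos, h.apply_self]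

theorem exists_continuousMap_features_eq_choiceProb {f : (Fin K → ℝ) → ℝ} (hfi : Integrable f)
    (hfe : ∀ (π : Equiv.Perm (Fin K)) (e : Fin K → ℝ), f (e ∘ π) = f e) {j : Fin K}
    {C : Set ((Fin K → ℝ) × Matrix (Fin K) (Fin K) ℝ)} (hC : IsCompact C)
    (hCcent : ∀ x ∈ C, IsCentered x) (hCrow : ∀ x ∈ C, HasUniqueRowPositions j x.2)
    (hCdom : C ⊆ choiceDomain j) :
    ∃ D : Set (FeatureIndex j → ℝ), IsCompact D ∧ ∃ Φ : C(D, ℝ),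
      ∀ x ∈ C, ∃ h : features j x ∈ D, Φ ⟨features j x, h⟩ = choiceProb f j x.1 x.2 := by
  have : CompactSpace C := isCompact_iff_compactSpace.1 hC
  let F (a : Σ _ : Enumeration j, C) : FeatureIndex j → ℝ := enumeratedFeatures a.1 a.2
  let P (a : Σ _ : Enumeration j, C) : ℝ := choiceProb f j a.2.1.1 a.2.1.2
  have hF : Continuous F :=
    continuous_sigma fun q => (continuous_enumeratedFeatures q).comp continuous_subtype_val
  have hP : Continuous P :=
    continuous_sigma fun _ => ((continuousOn_choiceProb hfi j).mono hCdom).domRestrict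
  have hPF : P.FactorsThrough F := by
    rintro ⟨q, x, hx⟩ ⟨r, y, hy⟩ hxy
    obtain ⟨π, ρ, h⟩ := exists_isRearrangement_of_enumeratedFeatures_eq hxy
    exact choiceProb_eq_of_isRearrangement hfe h (hCcent x hx) (hCcent y hy) (hCrow x hx)
      (hCdom hx).1
  obtain ⟨Φ, hΦ⟩ := exists_continuousMap_range_apply_eq hF hP hPF
  refine ⟨Set.range F, isCompact_range hF, Φ, fun x hx => ?_⟩
  obtain ⟨q, hq⟩ := exists_features_eq j x
  simp only [hq]
  exact ⟨⟨⟨q, x, hx⟩, rfl⟩, hΦ ⟨q, x, hx⟩⟩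

end DiscreteChoice

theorem theorem2_general {K : ℕ} (f : (Fin K → ℝ) → ℝ) (hfi : Integrable f)
    (hfe : ∀ (π : Equiv.Perm (Fin K)) (e : Fin K → ℝ), f (e ∘ π) = f e)
    (σ : ℝ → ℝ) (hσ : Continuous σ) (hσp : ¬ ∃ p : Polynomial ℝ, ∀ t, σ t = p.eval t)
    (j : Fin K) (C : Set ((Fin K → ℝ) × Matrix (Fin K) (Fin K) ℝ)) (hC : IsCompact C)
    (hCcent : ∀ x ∈ C, DiscreteChoice.IsCentered x)
    (hCrow : ∀ x ∈ C, DiscreteChoice.HasUniqueRowPositions j x.2)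
    (hCdom : C ⊆ DiscreteChoice.choiceDomain j) (ε : ℝ) (hε : 0 < ε) :
    ∃ N : DiscreteChoice.MLP (DiscreteChoice.FeatureIndex j), ∀ x ∈ C,
      |N.eval σ (DiscreteChoice.features j x) - DiscreteChoice.choiceProb f j x.1 x.2| < ε := by
  obtain ⟨D, hD, Φ, hΦ⟩ :=
    DiscreteChoice.exists_continuousMap_features_eq_choiceProb hfi hfe hC hCcent hCrow hCdom
  obtain ⟨N, hN⟩ := DiscreteChoice.exists_mlp_approx hD hσ hσp Φ hε
  refine ⟨N, fun x hx => ?_⟩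
  obtain ⟨hxD, hΦx⟩ := hΦ x hx
  exact hΦx ▸ hN ⟨DiscreteChoice.features j x, hxD⟩

theorem theorem2 {K : ℕ} (f : (Fin K → ℝ) → ℝ) (hf : DiscreteChoice.IsExchangeableDensity f)
    (σ : ℝ → ℝ) (hσ : Continuous σ) (hσp : ¬ ∃ p : Polynomial ℝ, ∀ t, σ t = p.eval t)
    (j : Fin K) (C : Set ((Fin K → ℝ) × Matrix (Fin K) (Fin K) ℝ)) (hC : IsCompact C)
    (hCX : C ⊆ DiscreteChoice.centeredSpace K \ DiscreteChoice.exceptionalSet j)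
    (hCdom : C ⊆ DiscreteChoice.choiceDomain j) (ε : ℝ) (hε : 0 < ε) :
    ∃ N : DiscreteChoice.MLP (DiscreteChoice.FeatureIndex j), ∀ x ∈ C,
      |N.eval σ (DiscreteChoice.features j x) - DiscreteChoice.choiceProb f j x.1 x.2| < ε := by
  exact theorem2_general f hf.integrable hf.exchangeable σ hσ hσp j C hC
    (fun _ hx => DiscreteChoice.isCentered_of_mem_centeredSpace (hCX hx).1)
    (fun _ hx => DiscreteChoice.hasUniqueRowPositions_of_notMem_exceptionalSet (hCX hx))
    hCdom ε hε
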